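/- For integers $k_1,\dots,k_{r-1}\ge 1$, $k_r\ge 2$ ($r\ge1$) let $$\zeta(k_1,\dots,k_r)=\sum_{0<n_1<n_2<\cdots<n_r}\frac{1}{n_1^{k_1}n_2^{k_2}\cdots n_r^{k_r}}$$ be the multiple zeta values, and call the $\mathbb{Q}$-subalgebra of $\mathbb{R}$ generated by all of them the algebra of multiple zeta values. **(i)** (Seki and Yamamoto) All the series below converge, and $$\zeta(3)=\sum_{n_1,n_2\ge 1}\frac{1}{n_1n_2}\cdot\frac{1\cdot 2\cdots n_2}{n_1(n_1+1)\cdots(n_1+n_2)}.$$ For all integers $k,l\ge 1$, $$\sum_{n_1,n_2\ge 1}\frac{1}{n_1^kn_2^l}\cdot\frac{1\cdot 2\cdots n_2}{n_1(n_1+1)\cdots(n_1+n_2)}=\begin{cases}\zeta(k+1,\underbrace{1,\dots,1}_{l-2},2), & l\ge 2,\\ \zeta(k+2), & l=1,\end{cases}$$ $$\zeta(k+l+1)=\sum_{n_1\ge 1,\;0<m_1<m_2<\cdots<m_l}\frac{1}{n_1^k\,m_1m_2\cdots m_l}\cdot\frac{1\cdot 2\cdots m_l}{n_1(n_1+1)\cdots(n_1+m_l)}.$$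 **(ii)** For all $r\ge 1$ and all integers $k_1,\dots,k_r\ge 1$, the series $$\sum_{n_1,\dots,n_r\ge 1}\frac{1}{n_1^{k_1}\cdots n_r^{k_r}}\cdot\frac{1}{n_1(n_1+n_2)\cdots(n_1+n_2+\cdots+n_r)}$$ and $$\sum_{\substack{n_1,\dots,n_r\ge 1\\ n_i<m_i,\;1\le i\le r}}\frac{1}{n_1^{k_1}\cdots n_r^{k_r}}\cdot\frac{1}{m_1(m_1+m_2)\cdots(m_1+\cdots+m_{r-1})(m_1+m_2+\cdots+m_r)^2}$$ (the second one over all integers $n_i,m_i$ with $1\le n_i<m_i$; for $r=1$ its second factor is $1/m_1^2$) converge, and their values lie in the algebra of multiple zeta values. -/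

import Mathlib

open scoped Nat

noncomputable section

/-- The multiple zeta value `ζ(k₁, …, k_r) = ∑_{0 < n₁ < ⋯ < n_r} 1 / (n₁^{k₁} ⋯ n_r^{k_r})`
(with the largest summation variable attached to the last entry), as a real number. -/
def mzv (k : List ℕ) : ℝ :=
  ∑' n : {n : Fin k.length → ℕ+ // StrictMono n}, ∏ i, 1 / ((n.1 i : ℕ) : ℝ) ^ k.get i

/-- The indices `(k₁, …, k_r)`, `r ≥ 1`, of the (convergent) multiple zeta values:
all `kᵢ ≥ 1`, and `k_r ≥ 2`. -/
def IsAdmissible (k : List ℕ) : Prop :=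
  (∀ a ∈ k, 1 ≤ a) ∧ ∃ h : k ≠ [], 2 ≤ k.getLast h

/-- The `ℚ`-algebra of multiple zeta values, inside `ℝ`. -/
def mzvAlgebra : Subalgebra ℚ ℝ :=
  Algebra.adjoin ℚ {x | ∃ k : List ℕ, IsAdmissible k ∧ x = mzv k}

/-- The factor `(1 · 2 ⋯ b) / (a · (a + 1) ⋯ (a + b))`. -/
def betaFactor (a b : ℕ+) : ℝ :=
  (((b : ℕ) ! : ℕ) : ℝ) / ∏ j ∈ Finset.range ((b : ℕ) + 1), (((a : ℕ) : ℝ) + (j : ℝ))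

/-- The partial sum `n₁ + ⋯ + nᵢ`, the index `i` included, as a real number. -/
def partialSum {r : ℕ} (n : Fin r → ℕ+) (i : Fin r) : ℝ :=
  ∑ j ∈ Finset.Iic i, ((n j : ℕ) : ℝ)

end

/-! All sums have nonnegative terms, so they are rearranged in `ℝ≥0∞`, and convergence follows once
a value is seen to be finite.

Part (i) uses the connector `C(a, b) = a! b! / (a + b)!`, for which the summand's last factor is
`C(a, b) / a`. Telescoping gives `∑_{a > N} C(a, b) / a = C(N, b) / b` (`tsum_connector`), which
trades a factor `1 / b` for a new summation variable. Repeating this in one variable or the other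
yields both families of identities. At `a = 0` it also gives `ζ(l + 2) = ζ(1, …, 1, 2)`, hence the
convergence of all admissible multiple zeta values.

Part (ii) uses generating series. With `Li_k = ∑ tⁿ / n^k`, the operator `∫ · dt / t` divides the
coefficient of `tⁿ` by `n`, so the partial sums in the denominators come from iterated integration
of `Li_{k_i} dt / t`; for the second series each form is also multiplied by `t / (1 - t)`, which
produces the `m_i > n_i`. By the shuffle product (`IsPolylog.mul_mem`) these integrals stay in the
span of multiple polylogarithms. A last integration against `dt / t` makes the top exponent at least
`2`, so the values at `t = 1` are combinations of multiple zeta values. -/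

open scoped ENNReal

/-! ### Sums over increasing sequences as iterated sums -/

/-- The sum over `N < n₁ < ⋯ < n_r` of `f n_r / (n₁ ^ k₁ ⋯ n_r ^ k_r)`, where `n_r` means `N` if `r = 0`. -/
noncomputable def chainSum : List ℕ → (ℕ → ℝ≥0∞) → ℕ → ℝ≥0∞
  | [], f, N => f N
  | a :: k, f, N =>
      ∑' i : ℕ, ENNReal.ofReal (1 / ((N + 1 + i : ℕ) : ℝ) ^ a) * chainSum k f (N + 1 + i)

theorem chainSum_append (k k' : List ℕ) (f : ℕ → ℝ≥0∞) :
    chainSum (k ++ k') f = chainSum k (chainSum k' f) := by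
  induction k with
  | nil => rfl
  | cons a k ih => funext N; simp only [List.cons_append, chainSum, ih]

/-- Strictly increasing sequences of length `l` with all terms above `N`. -/
abbrev ChainAbove (N l : ℕ) : Type :=
  {m : Fin l → ℕ+ // StrictMono m ∧ ∀ i, N < (m i : ℕ)}

/-- Prepending a term to an increasing sequence. -/
def ChainAbove.cons {N l : ℕ} (p : Σ i : ℕ, ChainAbove (N + 1 + i) l) : ChainAbove N (l + 1) :=
  ⟨Fin.cons (Nat.succPNat (N + p.1)) p.2.1, by
    constructor
    · intro i j
      refine Fin.cases ?_ (fun i => ?_) i <;> refine Fin.cases ?_ (fun j => ?_) j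
      · exact fun h => absurd h (lt_irrefl _)
      · intro _
        have := p.2.2.2 j
        rw [Fin.cons_zero, Fin.cons_succ, ← PNat.coe_lt_coe, Nat.succPNat_coe]
        omega
      · exact fun h => absurd h (Fin.not_lt_zero _)
      · intro h
        simpa only [Fin.cons_succ] using p.2.2.1 (Fin.succ_lt_succ_iff.1 h)
    · intro i
      refine Fin.cases ?_ (fun j => ?_) i
      · rw [Fin.cons_zero, Nat.succPNat_coe]; omega
      · have := p.2.2.2 j
        rw [Fin.cons_succ]; omega⟩

theorem ChainAbove.cons_bijective (N l : ℕ) :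
    Function.Bijective (ChainAbove.cons : (Σ i : ℕ, ChainAbove (N + 1 + i) l) → _) := by
  constructor
  · rintro ⟨i, p, hp⟩ ⟨j, q, hq⟩ h
    have h' : (Fin.cons (Nat.succPNat (N + i)) p : Fin (l + 1) → ℕ+) =
      Fin.cons (Nat.succPNat (N + j)) q := congrArg Subtype.val h
    obtain ⟨h1, rfl⟩ := Fin.cons_inj.1 h'
    obtain rfl : i = j := by
      have := Nat.succPNat_injective h1
      omega
    rfl
  · intro m
    have h0 := m.2.2 0
    have key : N + 1 + ((m.1 0 : ℕ) - (N + 1)) = m.1 0 := by omega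
    refine ⟨⟨(m.1 0 : ℕ) - (N + 1), fun i => m.1 i.succ,
      fun _ _ h => m.2.1 (Fin.succ_lt_succ_iff.2 h), fun i => ?_⟩, ?_⟩
    · rw [key]
      exact m.2.1 (Fin.succ_pos i)
    · apply Subtype.ext
      funext i
      refine Fin.cases ?_ (fun j => ?_) i
      · apply PNat.eq
        change ((Nat.succPNat (N + ((m.1 0 : ℕ) - (N + 1))) : ℕ+) : ℕ) = m.1 0
        rw [Nat.succPNat_coe]; omega
      · rfl

/-- Induction on `k`, splitting off the smallest variable. Prepending `N` gives the last entry a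
meaning for empty `k` too, where it is `N`. -/
theorem tsum_chainAbove (k : List ℕ) (f : ℕ → ℝ≥0∞) (N : ℕ) :
    ∑' m : ChainAbove N k.length,
      ENNReal.ofReal (∏ i, 1 / ((m.1 i : ℕ) : ℝ) ^ k.get i) *
        f ((Fin.cons N (fun i => (m.1 i : ℕ)) : Fin (k.length + 1) → ℕ) (Fin.last _)) =
      chainSum k f N := by
  induction k generalizing N with
  | nil =>
    have : Unique (ChainAbove N ([] : List ℕ).length) :=
      { default := ⟨fun i => i.elim0, fun i => i.elim0, fun i => i.elim0⟩
        uniq := fun m => Subtype.ext (funext fun i => i.elim0) }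
    rw [tsum_eq_single default fun m hm => absurd (Subsingleton.elim _ _) hm]
    simp [chainSum]
  | cons a k ih =>
    simp only [chainSum]
    refine ((Equiv.ofBijective _ (ChainAbove.cons_bijective N k.length)).tsum_eq _).symm.trans ?_
    rw [ENNReal.tsum_sigma']
    refine tsum_congr fun i => ?_
    rw [← ih, ← ENNReal.tsum_mul_left]
    refine tsum_congr fun m => ?_
    rw [← mul_assoc, ← ENNReal.ofReal_mul (by positivity)]
    have hN : ((Nat.succPNat (N + i) : ℕ+) : ℕ) = N + 1 + i := by
      rw [Nat.succPNat_coe]; omega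
    congr 2
    · refine (Fin.prod_univ_succ _).trans ?_
      congr 1
      · change 1 / (((Nat.succPNat (N + i) : ℕ+) : ℕ) : ℝ) ^ a = _
        rw [hN]
    · change (Fin.cons N _ : Fin (k.length + 1 + 1) → ℕ) (Fin.last _).succ = _
      rw [Fin.cons_succ]
      generalize Fin.last k.length = j
      refine Fin.cases ?_ (fun j => ?_) j
      · exact hN
      · rfl

theorem hasSum_of_tsum_ofReal {ι : Type*} {f : ι → ℝ} {s : ℝ} (hf : ∀ i, 0 ≤ f i) (hs : 0 ≤ s)
    (h : ∑' i, ENNReal.ofReal (f i) = ENNReal.ofReal s) : HasSum f s := by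
  have hsum : Summable f := by
    have := ENNReal.summable_toReal (f := fun i => ENNReal.ofReal (f i)) (by simp [h])
    simpa only [ENNReal.toReal_ofReal (hf _)] using this
  have := ENNReal.ofReal_tsum_of_nonneg hf hsum
  rw [h, ENNReal.ofReal_eq_ofReal_iff (tsum_nonneg hf) hs] at this
  exact this ▸ hsum.hasSum

theorem tsum_ofReal_mzv_summand (k : List ℕ) :
    ∑' n : {n : Fin k.length → ℕ+ // StrictMono n},
      ENNReal.ofReal (∏ i, 1 / ((n.1 i : ℕ) : ℝ) ^ k.get i) = chainSum k (fun _ => 1) 0 := by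
  rw [← tsum_chainAbove]
  let e : ChainAbove 0 k.length ≃ {n : Fin k.length → ℕ+ // StrictMono n} :=
    Equiv.subtypeEquivRight fun m => and_iff_left fun i => (m i).pos
  rw [← e.tsum_eq]
  refine tsum_congr fun m => ?_
  rw [mul_one]
  rfl

/-! ### The connector -/

/-- `a! b! / (a + b)!`. -/
noncomputable def connector (a b : ℕ) : ℝ := (a ! : ℝ) * (b ! : ℝ) / ((a + b)! : ℝ)

theorem connector_nonneg (a b : ℕ) : 0 ≤ connector a b := by
  unfold connector; positivity

theorem connector_comm (a b : ℕ) : connector a b = connector b a := by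
  unfold connector; rw [add_comm a b, mul_comm (a ! : ℝ)]

theorem connector_zero_left (b : ℕ) : connector 0 b = 1 := by
  unfold connector
  rw [Nat.factorial_zero, Nat.cast_one, one_mul, zero_add]
  exact div_self (by positivity)

/-- Equivalent to `(a + 1) C(a, b) = (a + b + 1) C(a + 1, b)`; this form makes the sum over `a`
telescope. -/
theorem connector_sub (a b : ℕ) (hb : b ≠ 0) :
    1 / ((a + 1 : ℕ) : ℝ) * connector (a + 1) b =
      1 / (b : ℝ) * connector a b - 1 / (b : ℝ) * connector (a + 1) b := by
  unfold connector
  have h1 : a + 1 + b = (a + b) + 1 := by omega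
  rw [h1, Nat.factorial_succ, Nat.factorial_succ]
  have hb' : (b : ℝ) ≠ 0 := by exact_mod_cast hb
  have h2 : ((a + b)! : ℝ) ≠ 0 := by positivity
  have h3 : ((a : ℝ) + b + 1) ≠ 0 := by positivity
  have h4 : ((a : ℝ) + 1) ≠ 0 := by positivity
  push_cast
  field_simp
  ring

/-- The connector decreases in `b`, and the bound is its value at `b = 1`. -/
theorem connector_le (a b : ℕ) (hb : b ≠ 0) : connector a b ≤ 1 / ((a + 1 : ℕ) : ℝ) := by
  induction b, Nat.one_le_iff_ne_zero.2 hb using Nat.le_induction with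
  | base =>
    unfold connector
    rw [Nat.factorial_succ]
    have h2 : (a ! : ℝ) ≠ 0 := by positivity
    have h4 : ((a : ℝ) + 1) ≠ 0 := by positivity
    rw [Nat.factorial_succ]
    push_cast
    apply le_of_eq
    field_simp
    simp
  | succ b hb ih =>
    refine le_trans ?_ (ih (by omega))
    unfold connector
    rw [← add_assoc, Nat.factorial_succ, Nat.factorial_succ, div_le_div_iff₀ (by positivity) (by positivity)]
    push_cast
    have : (0 : ℝ) ≤ (a ! : ℝ) * b ! * (a + b)! * a := by positivity
    nlinarith

theorem tendsto_connector (b : ℕ) (hb : b ≠ 0) :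
    Filter.Tendsto (fun a => connector a b) Filter.atTop (nhds 0) := by
  refine squeeze_zero (fun a => connector_nonneg a b) (fun a => connector_le a b hb) ?_
  simpa using tendsto_one_div_add_atTop_nhds_zero_nat (𝕜 := ℝ)

theorem tsum_connector (N b : ℕ) (hb : b ≠ 0) :
    ∑' i : ℕ, ENNReal.ofReal (1 / ((N + 1 + i : ℕ) : ℝ) * connector (N + 1 + i) b) =
      ENNReal.ofReal (1 / (b : ℝ) * connector N b) := by
  have hn : ∀ i : ℕ, 0 ≤ 1 / ((N + 1 + i : ℕ) : ℝ) * connector (N + 1 + i) b :=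
    fun i => mul_nonneg (by positivity) (connector_nonneg _ _)
  have h : HasSum (fun i : ℕ => 1 / ((N + 1 + i : ℕ) : ℝ) * connector (N + 1 + i) b)
      (1 / (b : ℝ) * connector N b) := by
    rw [hasSum_iff_tendsto_nat_of_nonneg hn]
    have e : ∀ n, ∑ i ∈ Finset.range n, 1 / ((N + 1 + i : ℕ) : ℝ) * connector (N + 1 + i) b =
        1 / (b : ℝ) * connector N b - 1 / (b : ℝ) * connector (n + N) b := by
      intro n
      have := Finset.sum_range_sub' (fun i => 1 / (b : ℝ) * connector (N + i) b) n
      simp only [add_zero] at this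
      rw [add_comm n N, ← this]
      refine Finset.sum_congr rfl fun i _ => ?_
      have e1 : N + 1 + i = N + i + 1 := by omega
      rw [e1, connector_sub _ _ hb, ← add_assoc]
    simp only [e]
    have := ((Filter.tendsto_add_atTop_iff_nat N).2 (tendsto_connector b hb)).const_mul (1 / (b : ℝ))
    simpa using this.const_sub (1 / (b : ℝ) * connector N b)
  rw [← ENNReal.ofReal_tsum_of_nonneg hn h.summable, h.tsum_eq]

theorem betaFactor_eq (a b : ℕ+) : betaFactor a b = 1 / ((a : ℕ) : ℝ) * connector a b := by
  have key : ∀ b : ℕ, (((a : ℕ)! : ℕ) : ℝ) * ∏ j ∈ Finset.range (b + 1), (((a : ℕ) : ℝ) + (j : ℝ)) =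
      (a : ℕ) * (((a : ℕ) + b)! : ℕ) := by
    intro b
    induction b with
    | zero => simp [mul_comm]
    | succ b ih =>
      rw [Finset.prod_range_succ, ← mul_assoc, ih, ← add_assoc, Nat.factorial_succ]
      push_cast
      ring
  have ha : (((a : ℕ)) : ℝ) ≠ 0 := by exact_mod_cast a.ne_zero
  have hp : ∏ j ∈ Finset.range ((b : ℕ) + 1), (((a : ℕ) : ℝ) + (j : ℝ)) ≠ 0 :=
    Finset.prod_ne_zero_iff.2 fun j _ => by positivity
  unfold betaFactor connector
  have h2 : (((a : ℕ) + b)! : ℝ) ≠ 0 := by positivity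
  have := key b
  field_simp
  linear_combination -this

/-- The sum `∑_{b ≥ 1} a! b! / ((a + b)! b ^ l)`. -/
noncomputable def connectorSum (l a : ℕ) : ℝ≥0∞ :=
  ∑' b : ℕ+, ENNReal.ofReal (1 / ((b : ℕ) : ℝ) ^ l * connector a b)

theorem connectorSum_zero_right (l : ℕ) :
    connectorSum l 0 = ∑' b : ℕ+, ENNReal.ofReal (1 / ((b : ℕ) : ℝ) ^ l) := by
  simp only [connectorSum, connector_zero_left, mul_one]

theorem connectorSum_one (a : ℕ) (ha : a ≠ 0) :
    connectorSum 1 a = ENNReal.ofReal (1 / (a : ℝ)) := by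
  have h := tsum_connector 0 a ha
  rw [connector_zero_left, mul_one] at h
  rw [← h, connectorSum, ← Equiv.pnatEquivNat.symm.tsum_eq]
  refine tsum_congr fun i => ?_
  have e : ((Equiv.pnatEquivNat.symm i : ℕ+) : ℕ) = 0 + 1 + i := by
    change ((Nat.succPNat i : ℕ+) : ℕ) = _
    rw [Nat.succPNat_coe]; omega
  rw [e, pow_one, connector_comm]

/-- One factor `1 / b` is turned by `tsum_connector` into a sum over a new variable above `a`, and
the two sums are exchanged. -/
theorem connectorSum_succ (l : ℕ) : connectorSum (l + 1) = chainSum [1] (connectorSum l) := by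
  funext a
  simp only [chainSum, connectorSum]
  simp only [← ENNReal.tsum_mul_left]
  rw [ENNReal.tsum_comm]
  refine tsum_congr fun b => ?_
  rw [pow_succ, ← one_div_mul_one_div, mul_assoc, ENNReal.ofReal_mul (by positivity),
    ← tsum_connector a b b.ne_zero, ← ENNReal.tsum_mul_left]
  refine tsum_congr fun i => ?_
  rw [← ENNReal.ofReal_mul (by positivity), ← ENNReal.ofReal_mul (by positivity)]
  congr 1
  ring

/-- The final exponent `2` joins the `1 / a` of `connectorSum_one` to the `1 / a` of the last
transport step. -/
theorem connectorSum_add_two (l : ℕ) :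
    connectorSum (l + 2) = chainSum (List.replicate l 1 ++ [2]) fun _ => 1 := by
  rw [chainSum_append]
  induction l with
  | zero =>
    rw [connectorSum_succ]
    funext a
    simp only [List.replicate_zero, chainSum]
    refine tsum_congr fun i => ?_
    rw [connectorSum_one _ (by omega), ← ENNReal.ofReal_mul (by positivity), mul_one]
    congr 1
    ring
  | succ l ih =>
    rw [connectorSum_succ, ih, List.replicate_succ]
    rfl

theorem chainSum_replicate_one_connector (l n N : ℕ) (hn : n ≠ 0) :
    chainSum (List.replicate l 1) (fun m => ENNReal.ofReal (connector n m)) N =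
      ENNReal.ofReal (1 / (n : ℝ) ^ l * connector n N) := by
  induction l generalizing N with
  | zero => simp [chainSum]
  | succ l ih =>
    simp only [List.replicate_succ, chainSum, ih, pow_one]
    rw [pow_succ, ← one_div_mul_one_div, mul_assoc, ENNReal.ofReal_mul (by positivity),
      connector_comm n N, ← tsum_connector N n hn, ← ENNReal.tsum_mul_left]
    refine tsum_congr fun i => ?_
    rw [← ENNReal.ofReal_mul (by positivity), ← ENNReal.ofReal_mul (by positivity),
      connector_comm n]
    congr 1
    ring

/-! ### Convergence of multiple zeta values -/

theorem IsAdmissible.exists_append {k : List ℕ} (hk : IsAdmissible k) :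
    ∃ (k' : List ℕ) (a : ℕ), k = k' ++ [a] ∧ 2 ≤ a ∧ ∀ b ∈ k', 1 ≤ b := by
  obtain ⟨h1, hne, h2⟩ := hk
  refine ⟨k.dropLast, k.getLast hne, (List.dropLast_append_getLast hne).symm, h2, fun b hb => ?_⟩
  exact h1 b (List.mem_of_mem_dropLast hb)

theorem isAdmissible_append {k : List ℕ} {a : ℕ} (ha : 2 ≤ a) (hk : ∀ b ∈ k, 1 ≤ b) :
    IsAdmissible (k ++ [a]) := by
  refine ⟨fun b hb => ?_, by simp, by simpa using ha⟩
  rcases List.mem_append.1 hb with h | h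
  · exact hk b h
  · rw [List.mem_singleton.1 h]; omega

theorem isAdmissible_singleton {a : ℕ} (ha : 2 ≤ a) : IsAdmissible [a] :=
  isAdmissible_append (k := []) ha (by simp)

theorem chainSum_exponent_mono {k k' : List ℕ} (h : List.Forall₂ (· ≤ ·) k k') (f : ℕ → ℝ≥0∞)
    (N : ℕ) : chainSum k' f N ≤ chainSum k f N := by
  induction h generalizing N with
  | nil => exact le_rfl
  | cons hab _ ih =>
    simp only [chainSum]
    gcongr with i
    · push_cast
      linarith [Nat.cast_nonneg (α := ℝ) N, Nat.cast_nonneg (α := ℝ) i]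
    · exact ih _

/-- Lowering exponents increases the sum, so `(1, …, 1, 2)` is the worst case of each length; there
the sum equals a single zeta value. -/
theorem chainSum_ne_top {k : List ℕ} (hk : IsAdmissible k) : chainSum k (fun _ => 1) 0 ≠ ∞ := by
  obtain ⟨k', a, rfl, ha, hk'⟩ := hk.exists_append
  have hle : List.Forall₂ (· ≤ ·) (List.replicate k'.length 1 ++ [2]) (k' ++ [a]) := by
    refine List.rel_append ?_ (List.Forall₂.cons ha List.Forall₂.nil)
    clear hk
    induction k' with
    | nil => exact List.Forall₂.nil
    | cons b k' ih =>
      exact List.Forall₂.cons (hk' b (by simp)) (ih fun c hc => hk' c (by simp [hc]))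
  refine ne_top_of_le_ne_top ?_ (chainSum_exponent_mono hle _ 0)
  rw [← connectorSum_add_two, connectorSum_zero_right]
  have : Summable fun b : ℕ+ => 1 / ((b : ℕ) : ℝ) ^ (k'.length + 2) :=
    (Real.summable_one_div_nat_pow.2 (by omega)).comp_injective PNat.coe_injective
  rw [← ENNReal.ofReal_tsum_of_nonneg (fun b => by positivity) this]
  exact ENNReal.ofReal_ne_top

theorem mzv_nonneg (k : List ℕ) : 0 ≤ mzv k :=
  tsum_nonneg fun _ => Finset.prod_nonneg fun _ _ => by positivity

theorem ofReal_mzv {k : List ℕ} (hk : IsAdmissible k) :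
    ENNReal.ofReal (mzv k) = chainSum k (fun _ => 1) 0 := by
  have hn : ∀ n : {n : Fin k.length → ℕ+ // StrictMono n},
      0 ≤ ∏ i, 1 / ((n.1 i : ℕ) : ℝ) ^ k.get i := fun n => Finset.prod_nonneg fun _ _ => by positivity
  have h : HasSum (fun n : {n : Fin k.length → ℕ+ // StrictMono n} =>
      ∏ i, 1 / ((n.1 i : ℕ) : ℝ) ^ k.get i) (chainSum k (fun _ => 1) 0).toReal :=
    hasSum_of_tsum_ofReal hn ENNReal.toReal_nonneg
      (by rw [ENNReal.ofReal_toReal (chainSum_ne_top hk), tsum_ofReal_mzv_summand])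
  rw [mzv, h.tsum_eq, ENNReal.ofReal_toReal (chainSum_ne_top hk)]

/-! ### The Seki–Yamamoto identities -/

theorem tsum_pnat_eq_chainSum (k : ℕ) (f : ℕ → ℝ≥0∞) :
    ∑' a : ℕ+, ENNReal.ofReal (1 / ((a : ℕ) : ℝ) ^ k) * f a = chainSum [k] f 0 := by
  simp only [chainSum]
  rw [← Equiv.pnatEquivNat.symm.tsum_eq]
  refine tsum_congr fun i => ?_
  have e : ((Equiv.pnatEquivNat.symm i : ℕ+) : ℕ) = 0 + 1 + i := by
    change ((Nat.succPNat i : ℕ+) : ℕ) = _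
    rw [Nat.succPNat_coe]; omega
  rw [e]

theorem betaFactor_nonneg (a b : ℕ+) : 0 ≤ betaFactor a b := by
  rw [betaFactor_eq]; exact mul_nonneg (by positivity) (connector_nonneg _ _)

theorem chainSum_singleton_one_div_pow (k l : ℕ) :
    chainSum [k] (fun a => ENNReal.ofReal (1 / (a : ℝ) ^ l)) 0 = chainSum [k + l] (fun _ => 1) 0 := by
  simp only [chainSum]
  refine tsum_congr fun i => ?_
  rw [← ENNReal.ofReal_mul (by positivity), mul_one, pow_add, one_div_mul_one_div]

theorem tsum_betaFactor (k l : ℕ) :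
    ∑' n : ℕ+ × ℕ+, ENNReal.ofReal
      (1 / (((n.1 : ℕ) : ℝ) ^ k * ((n.2 : ℕ) : ℝ) ^ l) * betaFactor n.1 n.2) =
      chainSum [k + 1] (connectorSum l) 0 := by
  rw [ENNReal.tsum_prod', ← tsum_pnat_eq_chainSum]
  refine tsum_congr fun a => ?_
  rw [connectorSum, ← ENNReal.tsum_mul_left]
  refine tsum_congr fun b => ?_
  rw [← ENNReal.ofReal_mul (by positivity), betaFactor_eq]
  congr 1
  have : (((a : ℕ)) : ℝ) ≠ 0 := by exact_mod_cast a.ne_zero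
  have : (((b : ℕ)) : ℝ) ≠ 0 := by exact_mod_cast b.ne_zero
  field_simp
  ring

theorem hasSum_betaFactor (k l : ℕ) (hl : 1 ≤ l) :
    HasSum
      (fun n : ℕ+ × ℕ+ =>
        1 / (((n.1 : ℕ) : ℝ) ^ k * ((n.2 : ℕ) : ℝ) ^ l) * betaFactor n.1 n.2)
      (if 2 ≤ l then mzv ((k + 1) :: (List.replicate (l - 2) 1 ++ [2])) else mzv [k + 2]) := by
  refine hasSum_of_tsum_ofReal (fun n => mul_nonneg (by positivity) (betaFactor_nonneg _ _))
    (by split_ifs <;> exact mzv_nonneg _) ?_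
  rw [tsum_betaFactor]
  split_ifs with h
  · have hadm : IsAdmissible (((k + 1) :: List.replicate (l - 2) 1) ++ [2]) := by
      refine isAdmissible_append le_rfl fun b hb => ?_
      rcases List.mem_cons.1 hb with rfl | hb
      · omega
      · rw [List.eq_of_mem_replicate hb]
    rw [← List.cons_append, ofReal_mzv hadm, List.cons_append]
    obtain ⟨l, rfl⟩ := Nat.exists_eq_add_of_le' h
    rw [connectorSum_add_two, Nat.add_sub_cancel]
    rfl
  · obtain rfl : l = 1 := by omega
    rw [ofReal_mzv (isAdmissible_singleton (by omega)),
      ← chainSum_singleton_one_div_pow (k + 1) 1]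
    refine tsum_congr fun i => ?_
    simp only [chainSum]
    rw [connectorSum_one _ (by omega), pow_one]

theorem tsum_chain_betaFactor (k l : ℕ) :
    ∑' p : ℕ+ × {m : Fin (l + 1) → ℕ+ // StrictMono m}, ENNReal.ofReal
      (1 / (((p.1 : ℕ) : ℝ) ^ k * ∏ i, ((p.2.1 i : ℕ) : ℝ)) *
        betaFactor p.1 (p.2.1 (Fin.last l))) = chainSum [k + (l + 1) + 1] (fun _ => 1) 0 := by
  have e1 : k + (l + 1) + 1 = (k + 1) + (l + 1) := by omega
  rw [e1, ← chainSum_singleton_one_div_pow, ENNReal.tsum_prod', ← tsum_pnat_eq_chainSum]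
  refine tsum_congr fun a => ?_
  have h0 := chainSum_replicate_one_connector (l + 1) a 0 a.ne_zero
  rw [connector_comm, connector_zero_left, mul_one] at h0
  rw [← h0]
  -- A general list of ones is used so that its length can be rewritten in the index type once
  -- `L.get` is gone.
  have h1 : ∀ (L : List ℕ) (hL : L.length = l + 1) (h1 : ∀ i, L.get i = 1),
      chainSum L (fun m => ENNReal.ofReal (connector a m)) 0 =
      ∑' m : {m : Fin (l + 1) → ℕ+ // StrictMono m},
        ENNReal.ofReal (∏ i, 1 / ((m.1 i : ℕ) : ℝ)) *
          ENNReal.ofReal (connector a (m.1 (Fin.last l))) := by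
    intro L hL h1
    rw [← tsum_chainAbove]
    simp only [h1, pow_one]
    rw [hL]
    let e : ChainAbove 0 (l + 1) ≃ {n : Fin (l + 1) → ℕ+ // StrictMono n} :=
      Equiv.subtypeEquivRight fun m => and_iff_left fun i => (m i).pos
    rw [← e.tsum_eq]
    rfl
  rw [h1 _ (by simp) (by simp), ← ENNReal.tsum_mul_left]
  refine tsum_congr fun m => ?_
  rw [← ENNReal.ofReal_mul (Finset.prod_nonneg fun _ _ => by positivity),
    ← ENNReal.ofReal_mul (by positivity), betaFactor_eq, Finset.prod_div_distrib,
    Finset.prod_const_one]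
  congr 1
  have : (((a : ℕ)) : ℝ) ≠ 0 := by exact_mod_cast a.ne_zero
  have : ∏ i, ((m.1 i : ℕ) : ℝ) ≠ 0 :=
    Finset.prod_ne_zero_iff.2 fun i _ => by exact_mod_cast (m.1 i).ne_zero
  field_simp
  ring

theorem hasSum_chain_betaFactor (k l : ℕ) (hl : 1 ≤ l) :
    HasSum
      (fun p : ℕ+ × {m : Fin l → ℕ+ // StrictMono m} =>
        1 / (((p.1 : ℕ) : ℝ) ^ k * ∏ i, ((p.2.1 i : ℕ) : ℝ)) *
          betaFactor p.1 (p.2.1 ⟨l - 1, Nat.sub_lt hl Nat.one_pos⟩))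
      (mzv [k + l + 1]) := by
  obtain ⟨l, rfl⟩ := Nat.exists_eq_add_of_le' hl
  refine hasSum_of_tsum_ofReal (fun n => mul_nonneg (by positivity) (betaFactor_nonneg _ _))
    (mzv_nonneg _) ?_
  rw [ofReal_mzv (isAdmissible_singleton (by omega)),
    ← tsum_chain_betaFactor]
  rfl

/-! ### Formal multiple polylogarithms and the shuffle product -/

namespace PolylogSeries

open PowerSeries

/-- The operator `f ↦ ∫ f dt / t`; the constant term of `f` is ignored. -/
noncomputable def integ : ℚ⟦X⟧ →ₗ[ℚ] ℚ⟦X⟧ where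
  toFun f := PowerSeries.mk fun n => coeff n f / n
  map_add' f g := by ext n; simp [add_div]
  map_smul' c f := by ext n; simp [mul_div_assoc]

theorem coeff_integ (n : ℕ) (f : ℚ⟦X⟧) : coeff n (integ f) = coeff n f / n := by
  simp [integ]

/-- The power series of `t / (1 - t)`. -/
noncomputable def geom : ℚ⟦X⟧ := PowerSeries.mk fun n => if n = 0 then 0 else 1

theorem coeff_geom_mul (n : ℕ) (f : ℚ⟦X⟧) :
    coeff n (geom * f) = ∑ m ∈ Finset.range n, coeff m f := by
  rw [mul_comm, coeff_mul, Finset.Nat.sum_antidiagonal_eq_sum_range_succ_mk, Finset.sum_range_succ]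
  simp only [geom, coeff_mk, Nat.sub_self, if_true, mul_zero, add_zero]
  refine Finset.sum_congr rfl fun m hm => ?_
  rw [if_neg (by have := Finset.mem_range.1 hm; omega), mul_one]

theorem coeff_zero_integ (f : ℚ⟦X⟧) : coeff 0 (integ f) = 0 := by simp [coeff_integ]

theorem coeff_zero_geom_mul (f : ℚ⟦X⟧) : coeff 0 (geom * f) = 0 := by simp [coeff_geom_mul]

theorem X_mul_derivative_integ {f : ℚ⟦X⟧} (hf : coeff 0 f = 0) : X * d⁄dX ℚ (integ f) = f := by
  ext n
  cases n with
  | zero => simpa using hf.symm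
  | succ n =>
    rw [coeff_succ_X_mul, coeff_derivative, coeff_integ]
    have : (n : ℚ) + 1 ≠ 0 := by positivity
    push_cast
    field_simp

theorem integ_X_mul_derivative {f : ℚ⟦X⟧} (hf : coeff 0 f = 0) : integ (X * d⁄dX ℚ f) = f := by
  ext n
  cases n with
  | zero => rw [coeff_zero_integ, hf]
  | succ n =>
    rw [coeff_integ, coeff_succ_X_mul, coeff_derivative]
    have : (n : ℚ) + 1 ≠ 0 := by positivity
    push_cast
    field_simp

/-- Integration by parts. -/
theorem integ_mul_integ {f g : ℚ⟦X⟧} (hf : coeff 0 f = 0) (hg : coeff 0 g = 0) :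
    integ f * integ g = integ (f * integ g) + integ (integ f * g) := by
  have h0 : coeff 0 (integ f * integ g) = 0 := by
    simp [coeff_mul, coeff_zero_integ]
  rw [← integ_X_mul_derivative h0, ← map_add, Derivation.leibniz]
  have h1 := X_mul_derivative_integ hf
  have h2 := X_mul_derivative_integ hg
  congr 1
  simp only [smul_eq_mul]
  linear_combination integ f * h2 + integ g * h1

/-- The integrands `1` and `t / (1 - t)`, relative to `dt / t`. -/
def IsLetter (e : ℚ⟦X⟧) : Prop := e = 1 ∨ e = geom

/-- The multiple polylogarithms, in one variable, of positive depth. -/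
inductive IsPolylog : ℚ⟦X⟧ → Prop
  | base : IsPolylog (integ (geom * 1))
  | step {e f : ℚ⟦X⟧} : IsLetter e → IsPolylog f → IsPolylog (integ (e * f))

theorem IsPolylog.coeff_zero {f : ℚ⟦X⟧} (hf : IsPolylog f) : coeff 0 f = 0 := by
  cases hf <;> exact coeff_zero_integ _

theorem IsLetter.coeff_zero_mul {e f : ℚ⟦X⟧} (he : IsLetter e) (hf : IsPolylog f) :
    coeff 0 (e * f) = 0 := by
  rcases he with rfl | rfl
  · rw [one_mul, hf.coeff_zero]
  · exact coeff_zero_geom_mul f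

/-- The span of the multiple polylogarithms of positive depth. -/
noncomputable def polylogSpan : Submodule ℚ ℚ⟦X⟧ := Submodule.span ℚ {f | IsPolylog f}

theorem IsPolylog.mem {f : ℚ⟦X⟧} (hf : IsPolylog f) : f ∈ polylogSpan := Submodule.subset_span hf

theorem IsLetter.integ_mul_mem {e f : ℚ⟦X⟧} (he : IsLetter e) (hf : f ∈ polylogSpan) :
    integ (e * f) ∈ polylogSpan := by
  have : polylogSpan ≤ polylogSpan.comap (integ ∘ₗ LinearMap.mulLeft ℚ e) :=
    Submodule.span_le.2 fun g hg => Submodule.subset_span (IsPolylog.step he hg)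
  exact this hf

/-- The inductive step of the shuffle product formula. -/
theorem integ_mul_integ_mem {d e f g : ℚ⟦X⟧} (hd : IsLetter d) (he : IsLetter e)
    (hdf : coeff 0 (d * f) = 0) (heg : coeff 0 (e * g) = 0)
    (hf : f * integ (e * g) ∈ polylogSpan) (hg : integ (d * f) * g ∈ polylogSpan) :
    integ (d * f) * integ (e * g) ∈ polylogSpan := by
  rw [integ_mul_integ hdf heg, mul_assoc, mul_left_comm _ e]
  exact add_mem (hd.integ_mul_mem hf) (he.integ_mul_mem hg)

/-- Double induction on the two words of letters. The series `1` is not in the span, so the base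
cases are handled directly: there the product with `1` is the other factor. -/
theorem IsPolylog.mul_mem {f g : ℚ⟦X⟧} (hf : IsPolylog f) (hg : IsPolylog g) :
    f * g ∈ polylogSpan := by
  have hgeom : IsLetter geom := Or.inr rfl
  induction hf generalizing g with
  | base =>
    induction hg with
    | base =>
      refine integ_mul_integ_mem hgeom hgeom (coeff_zero_geom_mul _) (coeff_zero_geom_mul _) ?_ ?_
      · rw [one_mul]; exact IsPolylog.base.mem
      · rw [mul_one]; exact IsPolylog.base.mem
    | step he hg ih =>
      refine integ_mul_integ_mem hgeom he (coeff_zero_geom_mul _) (he.coeff_zero_mul hg) ?_ ih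
      rw [one_mul]; exact (IsPolylog.step he hg).mem
  | step hd hf ihf =>
    induction hg with
    | base =>
      refine integ_mul_integ_mem hd hgeom (hd.coeff_zero_mul hf) (coeff_zero_geom_mul _)
        (ihf IsPolylog.base) ?_
      rw [mul_one]; exact (IsPolylog.step hd hf).mem
    | step he hg ih =>
      exact integ_mul_integ_mem hd he (hd.coeff_zero_mul hf) (he.coeff_zero_mul hg)
        (ihf (IsPolylog.step he hg)) ih

theorem mul_mem_polylogSpan {f g : ℚ⟦X⟧} (hf : f ∈ polylogSpan) (hg : g ∈ polylogSpan) :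
    f * g ∈ polylogSpan := by
  induction hf using Submodule.span_induction with
  | mem f hf =>
    induction hg using Submodule.span_induction with
    | mem g hg => exact IsPolylog.mul_mem hf hg
    | zero => rw [mul_zero]; exact zero_mem _
    | add x y _ _ hx hy => rw [mul_add]; exact add_mem hx hy
    | smul c x _ hx => rw [mul_smul_comm]; exact Submodule.smul_mem _ _ hx
  | zero => rw [zero_mul]; exact zero_mem _
  | add x y _ _ hx hy => rw [add_mul]; exact add_mem hx hy
  | smul c x _ hx => rw [smul_mul_assoc]; exact Submodule.smul_mem _ _ hx

/-- The multiple polylogarithm with index list `k`, the exponent of the largest summation variable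
coming first. -/
noncomputable def polylog : List ℕ → ℚ⟦X⟧
  | [] => 1
  | a :: k => integ^[a] (geom * polylog k)

theorem coeff_integ_iterate (a n : ℕ) (f : ℚ⟦X⟧) :
    coeff n (integ^[a] f) = coeff n f / (n : ℚ) ^ a := by
  induction a with
  | zero => simp
  | succ a ih => rw [Function.iterate_succ_apply', coeff_integ, ih, pow_succ, div_div]

theorem coeff_polylog_cons (a n : ℕ) (k : List ℕ) :
    coeff n (polylog (a :: k)) = (∑ m ∈ Finset.range n, coeff m (polylog k)) / (n : ℚ) ^ a := by
  rw [polylog, coeff_integ_iterate, coeff_geom_mul]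

theorem coeff_polylog_nonneg (k : List ℕ) (n : ℕ) : 0 ≤ coeff n (polylog k) := by
  induction k generalizing n with
  | nil => rw [polylog, coeff_one]; split_ifs <;> simp
  | cons a k ih =>
    rw [coeff_polylog_cons]
    exact div_nonneg (Finset.sum_nonneg fun m _ => ih m) (by positivity)

/-- Integrating with the letter `1` raises the first exponent; with `geom` it prepends a new
exponent `1`. -/
theorem IsPolylog.exists_eq_polylog {f : ℚ⟦X⟧} (hf : IsPolylog f) :
    ∃ (a : ℕ) (k : List ℕ), 1 ≤ a ∧ (∀ b ∈ k, 1 ≤ b) ∧ f = polylog (a :: k) := by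
  induction hf with
  | base => exact ⟨1, [], le_rfl, by simp, rfl⟩
  | step he _ ih =>
    obtain ⟨a, k, ha, hk, rfl⟩ := ih
    rcases he with rfl | rfl
    · refine ⟨a + 1, k, by omega, hk, ?_⟩
      rw [one_mul, polylog, polylog, Function.iterate_succ_apply']
    · exact ⟨1, a :: k, le_rfl, by simpa using ⟨ha, hk⟩, rfl⟩

theorem polylog_singleton_mem {a : ℕ} (ha : 1 ≤ a) : polylog [a] ∈ polylogSpan := by
  induction a, ha using Nat.le_induction with
  | base => exact IsPolylog.base.mem
  | succ a _ ih =>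
    rw [polylog, Function.iterate_succ_apply', ← one_mul (integ^[a] _)]
    exact IsLetter.integ_mul_mem (Or.inl rfl) ih

/-! ### Values at `1`: sums of coefficients against test functions -/

theorem tsum_ite_lt (N : ℕ) (g : ℕ → ℝ≥0∞) :
    ∑' n : ℕ, (if N < n then g n else 0) = ∑' i : ℕ, g (N + 1 + i) := by
  rw [← Function.Injective.tsum_eq (add_right_injective (N + 1))]
  · refine tsum_congr fun i => if_pos ?_
    omega
  · intro n hn
    have h : N < n := by
      by_contra h
      exact hn (if_neg h)
    exact ⟨n - (N + 1), by simp only; omega⟩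

/-- The `n`-th coefficient of a power series with nonnegative coefficients. -/
noncomputable def nnCoeff (f : ℚ⟦X⟧) (n : ℕ) : ℝ≥0∞ := ENNReal.ofReal ((coeff n f : ℚ) : ℝ)

theorem nnCoeff_one_mul (n : ℕ) (x : ℝ≥0∞) : nnCoeff 1 n * x = if n = 0 then x else 0 := by
  rw [nnCoeff, coeff_one]
  split_ifs <;> simp

theorem tsum_nnCoeff_one (g : ℕ → ℝ≥0∞) : ∑' n, nnCoeff 1 n * g n = g 0 := by
  simp only [nnCoeff_one_mul]
  exact tsum_ite_eq 0 _

theorem nnCoeff_integ (f : ℚ⟦X⟧) (n : ℕ) :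
    nnCoeff (integ f) n = nnCoeff f n * ENNReal.ofReal (1 / (n : ℝ)) := by
  rw [nnCoeff, nnCoeff, coeff_integ, ← ENNReal.ofReal_mul' (by positivity)]
  push_cast
  rw [mul_one_div]

theorem nnCoeff_mul {f g : ℚ⟦X⟧} (hf : ∀ n, 0 ≤ coeff n f) (hg : ∀ n, 0 ≤ coeff n g) (n : ℕ) :
    nnCoeff (f * g) n = ∑ p ∈ Finset.HasAntidiagonal.antidiagonal n, nnCoeff f p.1 * nnCoeff g p.2 := by
  simp only [nnCoeff]
  rw [coeff_mul]
  push_cast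
  rw [ENNReal.ofReal_sum_of_nonneg fun p _ =>
    mul_nonneg (by exact_mod_cast hf p.1) (by exact_mod_cast hg p.2)]
  exact Finset.sum_congr rfl fun p _ => ENNReal.ofReal_mul (by exact_mod_cast hf p.1)

theorem tsum_nnCoeff_mul {f g : ℚ⟦X⟧} (hf : ∀ n, 0 ≤ coeff n f) (hg : ∀ n, 0 ≤ coeff n g)
    (h : ℕ → ℝ≥0∞) :
    ∑' n, nnCoeff (f * g) n * h n = ∑' n, nnCoeff f n * ∑' m, nnCoeff g m * h (n + m) := by
  simp only [← ENNReal.tsum_mul_left]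
  rw [← ENNReal.tsum_prod (f := fun n m => nnCoeff f n * (nnCoeff g m * h (n + m))),
    ← Finset.HasAntidiagonal.sigmaAntidiagonalEquivProd.tsum_eq, ENNReal.tsum_sigma']
  refine tsum_congr fun n => ?_
  rw [nnCoeff_mul hf hg, Finset.sum_mul, tsum_fintype,
    ← Finset.sum_coe_sort (Finset.HasAntidiagonal.antidiagonal n)]
  refine Finset.sum_congr rfl fun p _ => ?_
  have hp : p.1.1 + p.1.2 = n := Finset.HasAntidiagonal.mem_antidiagonal.1 p.2
  rw [mul_assoc]
  change _ = nnCoeff f p.1.1 * (nnCoeff g p.1.2 * h (p.1.1 + p.1.2))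
  rw [hp]

theorem coeff_integ_nonneg {f : ℚ⟦X⟧} (hf : ∀ n, 0 ≤ coeff n f) (n : ℕ) : 0 ≤ coeff n (integ f) := by
  rw [coeff_integ]
  exact div_nonneg (hf n) (by positivity)

theorem coeff_mul_nonneg {f g : ℚ⟦X⟧} (hf : ∀ n, 0 ≤ coeff n f) (hg : ∀ n, 0 ≤ coeff n g) (n : ℕ) :
    0 ≤ coeff n (f * g) := by
  rw [coeff_mul]
  exact Finset.sum_nonneg fun p _ => mul_nonneg (hf _) (hg _)

theorem tsum_nnCoeff_geom_mul {f : ℚ⟦X⟧} (hf : ∀ n, 0 ≤ coeff n f) (h : ℕ → ℝ≥0∞) :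
    ∑' n, nnCoeff (geom * f) n * h n = ∑' n, nnCoeff f n * ∑' i, h (n + 1 + i) := by
  have e : ∀ n, nnCoeff (geom * f) n * h n = ∑' m, if m < n then nnCoeff f m * h n else 0 := by
    intro n
    rw [nnCoeff, coeff_geom_mul]
    push_cast
    rw [ENNReal.ofReal_sum_of_nonneg fun m _ => by exact_mod_cast hf m, Finset.sum_mul,
      tsum_eq_sum (s := Finset.range n) fun m hm => if_neg fun h => hm (Finset.mem_range.2 h)]
    exact Finset.sum_congr rfl fun m hm => (if_pos (Finset.mem_range.1 hm)).symm
  simp only [e]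
  rw [ENNReal.tsum_comm]
  refine tsum_congr fun m => ?_
  rw [tsum_ite_lt, ENNReal.tsum_mul_left]

theorem nnCoeff_integ_iterate (a n : ℕ) (f : ℚ⟦X⟧) :
    nnCoeff (integ^[a] f) n = nnCoeff f n * ENNReal.ofReal (1 / (n : ℝ) ^ a) := by
  rw [nnCoeff, nnCoeff, coeff_integ_iterate, ← ENNReal.ofReal_mul' (by positivity)]
  push_cast
  rw [mul_one_div]

/-- The test function `h` is arbitrary because the induction absorbs the sum over the largest
variable into it. -/
theorem tsum_nnCoeff_polylog (k : List ℕ) (h : ℕ → ℝ≥0∞) :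
    ∑' n, nnCoeff (polylog k) n * h n = chainSum k.reverse h 0 := by
  induction k generalizing h with
  | nil => exact tsum_nnCoeff_one h
  | cons a k ih =>
    rw [List.reverse_cons, chainSum_append, ← ih]
    simp only [polylog, nnCoeff_integ_iterate, mul_assoc]
    exact tsum_nnCoeff_geom_mul (coeff_polylog_nonneg k) _

theorem hasSum_coeff_polylog {k : List ℕ} (hk : IsAdmissible k.reverse) :
    HasSum (fun n => ((coeff n (polylog k) : ℚ) : ℝ)) (mzv k.reverse) := by
  refine hasSum_of_tsum_ofReal (fun n => by exact_mod_cast coeff_polylog_nonneg k n) (mzv_nonneg _) ?_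
  rw [ofReal_mzv hk, ← tsum_nnCoeff_polylog]
  simp only [mul_one]
  rfl

/-- The extra `integ` raises the exponent of the largest variable to at least `2`, which is exactly
admissibility. -/
theorem exists_hasSum_coeff_integ {f : ℚ⟦X⟧} (hf : f ∈ polylogSpan) :
    ∃ s ∈ mzvAlgebra, HasSum (fun n => ((coeff n (integ f) : ℚ) : ℝ)) s := by
  induction hf using Submodule.span_induction with
  | mem f hf =>
    obtain ⟨a, k, ha, hk, rfl⟩ := IsPolylog.exists_eq_polylog hf
    have hadm : IsAdmissible ((a + 1) :: k).reverse := by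
      rw [List.reverse_cons]
      exact isAdmissible_append (by omega) (by simpa using hk)
    refine ⟨_, Algebra.subset_adjoin ⟨_, hadm, rfl⟩, ?_⟩
    have := hasSum_coeff_polylog hadm
    rwa [polylog, Function.iterate_succ_apply'] at this
  | zero => exact ⟨0, zero_mem _, by simp⟩
  | add x y _ _ hx hy =>
    obtain ⟨s, hs, hs'⟩ := hx
    obtain ⟨t, ht, ht'⟩ := hy
    refine ⟨s + t, add_mem hs ht, ?_⟩
    simpa using hs'.add ht'
  | smul c x _ hx =>
    obtain ⟨s, hs, hs'⟩ := hx
    refine ⟨c • s, Subalgebra.smul_mem _ hs c, ?_⟩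
    simpa [Rat.smul_def] using hs'.mul_left (c : ℝ)

/-! ### Iterated integrals and the series of part (ii) -/

/-- The iterated integral of the forms `P i * dt / t`. -/
noncomputable def iterInteg : (r : ℕ) → (Fin r → ℚ⟦X⟧) → ℚ⟦X⟧
  | 0, _ => 1
  | r + 1, P => integ (iterInteg r (fun i => P i.castSucc) * P (Fin.last r))

theorem coeff_iterInteg_nonneg (r : ℕ) (P : Fin r → ℚ⟦X⟧) (hP : ∀ i n, 0 ≤ coeff n (P i)) (n : ℕ) :
    0 ≤ coeff n (iterInteg r P) := by
  induction r generalizing n with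
  | zero => rw [iterInteg, coeff_one]; split_ifs <;> simp
  | succ r ih =>
    exact coeff_integ_nonneg (coeff_mul_nonneg (ih _ fun i => hP _) (hP _)) n

theorem sum_Iic_castSucc {r : ℕ} (x : Fin (r + 1) → ℝ) (i : Fin r) :
    ∑ j ∈ Finset.Iic i.castSucc, x j = ∑ j ∈ Finset.Iic i, x j.castSucc := by
  rw [← Fin.map_castSuccEmb_Iic, Finset.sum_map]
  rfl

/-- Summation over `Fin r → ι` of a product of weights divided by the partial sums of the degrees, in
terms of the generating series `P i` of the weights. -/
theorem tsum_iterInteg {ι : Type*} (d : ι → ℕ) (r : ℕ) (w : Fin r → ι → ℝ) (P : Fin r → ℚ⟦X⟧)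
    (hw : ∀ i x, 0 ≤ w i x) (hP : ∀ i n, 0 ≤ coeff n (P i))
    (h : ∀ i (g : ℕ → ℝ≥0∞), ∑' x, ENNReal.ofReal (w i x) * g (d x) = ∑' n, nnCoeff (P i) n * g n)
    (g : ℕ → ℝ≥0∞) :
    ∑' x : Fin r → ι, ENNReal.ofReal ((∏ i, w i (x i)) *
        (1 / ∏ i, ∑ j ∈ Finset.Iic i, (d (x j) : ℝ))) * g (∑ i, d (x i)) =
      ∑' n, nnCoeff (iterInteg r P) n * g n := by
  induction r generalizing g with
  | zero =>
    rw [iterInteg, tsum_nnCoeff_one, tsum_eq_single default fun m hm => absurd (Subsingleton.elim _ _) hm]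
    simp
  | succ r ih =>
    rw [← (Fin.snocEquiv fun _ => ι).tsum_eq, ENNReal.tsum_prod', iterInteg]
    simp only [nnCoeff_integ, mul_assoc]
    rw [tsum_nnCoeff_mul (coeff_iterInteg_nonneg _ _ fun i => hP _) (hP _)]
    -- The last variable is summed against the shifted test function, which already carries the
    -- reciprocal of the total degree.
    simp only [← h (Fin.last r) fun m => ENNReal.ofReal (1 / ((_ + m : ℕ) : ℝ)) * g (_ + m)]
    rw [← ih _ _ (fun i => hw _) (fun i => hP _) fun i => h _, ENNReal.tsum_comm]
    refine tsum_congr fun x => ?_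
    rw [← ENNReal.tsum_mul_left]
    refine tsum_congr fun a => ?_
    have e1 : ∀ i : Fin r, (Fin.snocEquiv fun _ => ι) (a, x) i.castSucc = x i := fun i => by
      simp [Fin.snocEquiv]
    have e2 : (Fin.snocEquiv fun _ => ι) (a, x) (Fin.last r) = a := by
      simp [Fin.snocEquiv]
    rw [Fin.prod_univ_castSucc, Fin.prod_univ_castSucc, Fin.sum_univ_castSucc]
    simp only [sum_Iic_castSucc, e1, e2]
    have e3 : ∑ j ∈ Finset.Iic (Fin.last r), (d ((Fin.snocEquiv fun _ => ι) (a, x) j) : ℝ) =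
        ((∑ i, d (x i) + d a : ℕ) : ℝ) := by
      rw [show Finset.Iic (Fin.last r) = Finset.univ from Finset.Iic_top, Fin.sum_univ_castSucc]
      simp only [e1, e2]
      push_cast
      rfl
    rw [e3, ← mul_assoc, ← mul_assoc,
      ← ENNReal.ofReal_mul
        (mul_nonneg (Finset.prod_nonneg fun i _ => hw _ _)
          (one_div_nonneg.2 (Finset.prod_nonneg fun i _ => Finset.sum_nonneg fun j _ => by positivity))),
      ← ENNReal.ofReal_mul' (by positivity), ← one_div_mul_one_div]
    congr 2
    ring

theorem iterInteg_mem {r : ℕ} {P : Fin r → ℚ⟦X⟧} (hr : 1 ≤ r)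
    (hP : ∀ (i : Fin r) (f : ℚ⟦X⟧), f = 1 ∨ f ∈ polylogSpan → integ (f * P i) ∈ polylogSpan) :
    iterInteg r P ∈ polylogSpan := by
  induction r, hr using Nat.le_induction with
  | base => exact hP _ _ (Or.inl rfl)
  | succ r _ ih => exact hP _ _ (Or.inr (ih fun i => hP _))

theorem tsum_weight_pnat (a : ℕ) (g : ℕ → ℝ≥0∞) :
    ∑' x : ℕ+, ENNReal.ofReal (1 / ((x : ℕ) : ℝ) ^ a) * g x =
      ∑' n, nnCoeff (polylog [a]) n * g n := by
  rw [tsum_nnCoeff_polylog, tsum_pnat_eq_chainSum]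
  rfl

/-- Multiplication by `geom` sums over all strictly larger exponents, here the second component. -/
theorem tsum_weight_pair (a : ℕ) (g : ℕ → ℝ≥0∞) :
    ∑' x : {x : ℕ+ × ℕ+ // x.1 < x.2}, ENNReal.ofReal (1 / ((x.1.1 : ℕ) : ℝ) ^ a) * g x.1.2 =
      ∑' n, nnCoeff (geom * polylog [a]) n * g n := by
  rw [tsum_nnCoeff_geom_mul (coeff_polylog_nonneg _), ← tsum_weight_pnat]
  let e : (Σ _ : ℕ+, ℕ) ≃ {x : ℕ+ × ℕ+ // x.1 < x.2} :=
    { toFun := fun p => ⟨(p.1, ⟨(p.1 : ℕ) + 1 + p.2, by omega⟩), by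
        exact PNat.coe_lt_coe _ _ |>.1 (show (p.1 : ℕ) < (p.1 : ℕ) + 1 + p.2 by omega)⟩
      invFun := fun x => ⟨x.1.1, (x.1.2 : ℕ) - (x.1.1 + 1)⟩
      left_inv := fun p => by
        simp
      right_inv := fun x => by
        have h : (x.1.1 : ℕ) < x.1.2 := x.2
        refine Subtype.ext (Prod.ext rfl (PNat.eq ?_))
        change (x.1.1 : ℕ) + 1 + ((x.1.2 : ℕ) - (x.1.1 + 1)) = x.1.2
        omega }
  rw [← e.tsum_eq, ENNReal.tsum_sigma']
  refine tsum_congr fun n => ?_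
  rw [← ENNReal.tsum_mul_left]
  rfl

theorem exists_hasSum_partialSum (r : ℕ) (k : Fin r → ℕ) (hr : 1 ≤ r) (hk : ∀ i, 1 ≤ k i) :
    ∃ s ∈ mzvAlgebra,
      HasSum
        (fun n : Fin r → ℕ+ =>
          1 / (∏ i, ((n i : ℕ) : ℝ) ^ k i) * (1 / ∏ i, partialSum n i))
        s := by
  obtain ⟨r, rfl⟩ := Nat.exists_eq_add_of_le' hr
  have hmem : iterInteg r (fun i => polylog [k i.castSucc]) * polylog [k (Fin.last r)] ∈
      polylogSpan := by
    rcases Nat.eq_zero_or_pos r with rfl | hr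
    · rw [iterInteg, one_mul]
      exact polylog_singleton_mem (hk _)
    · refine mul_mem_polylogSpan (iterInteg_mem hr fun i f hf => ?_) (polylog_singleton_mem (hk _))
      have h1 := polylog_singleton_mem (hk i.castSucc)
      rw [← one_mul (f * _)]
      refine IsLetter.integ_mul_mem (Or.inl rfl) ?_
      rcases hf with rfl | hf
      · rwa [one_mul]
      · exact mul_mem_polylogSpan hf h1
  obtain ⟨s, hs, hsum⟩ := exists_hasSum_coeff_integ hmem
  refine ⟨s, hs, ?_⟩
  change HasSum (fun n => ((coeff n (iterInteg (r + 1) fun i => polylog [k i]) : ℚ) : ℝ)) s at hsum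
  have hP : ∀ (i : Fin (r + 1)) n, 0 ≤ coeff n (polylog [k i]) := fun i => coeff_polylog_nonneg _
  have hn : ∀ n, (0 : ℝ) ≤ (coeff n (iterInteg (r + 1) fun i => polylog [k i]) : ℚ) := fun n => by
    exact_mod_cast coeff_iterInteg_nonneg _ _ hP n
  refine hasSum_of_tsum_ofReal (fun n => ?_) (hsum.nonneg hn) ?_
  · have : ∀ i, 0 ≤ partialSum n i := fun i => Finset.sum_nonneg fun j _ => by positivity
    exact mul_nonneg (by positivity) (one_div_nonneg.2 (Finset.prod_nonneg fun i _ => this i))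
  · rw [← hsum.tsum_eq, ENNReal.ofReal_tsum_of_nonneg hn hsum.summable]
    have := tsum_iterInteg (fun n : ℕ+ => (n : ℕ)) (r + 1) (fun i n => 1 / ((n : ℕ) : ℝ) ^ k i)
      (fun i => polylog [k i]) (fun i x => by positivity) hP (fun i => tsum_weight_pnat _) fun _ => 1
    simp only [mul_one, Finset.prod_div_distrib, Finset.prod_const_one] at this
    exact this

theorem prod_partialSum_pow {r : ℕ} (n : Fin (r + 1) → ℕ+) :
    ∏ i, partialSum n i ^ (if (i : ℕ) + 1 = r + 1 then 2 else 1) =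
      (∏ i, partialSum n i) * ((∑ i, (n i : ℕ) : ℕ) : ℝ) := by
  rw [Fin.prod_univ_castSucc, Fin.prod_univ_castSucc, Fin.val_last, if_pos rfl, pow_two, mul_assoc]
  congr 1
  · refine Finset.prod_congr rfl fun i _ => ?_
    rw [if_neg (by rw [Fin.val_castSucc]; have := i.2; omega), pow_one]
  · congr 1
    rw [partialSum, show Finset.Iic (Fin.last r) = Finset.univ from Finset.Iic_top]
    push_cast
    rfl

theorem exists_hasSum_partialSum_pair (r : ℕ) (k : Fin r → ℕ) (hr : 1 ≤ r) (hk : ∀ i, 1 ≤ k i) :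
    ∃ s ∈ mzvAlgebra,
      HasSum
        (fun p : {p : (Fin r → ℕ+) × (Fin r → ℕ+) // ∀ i, p.1 i < p.2 i} =>
          1 / (∏ i, ((p.1.1 i : ℕ) : ℝ) ^ k i) *
            (1 / ∏ i : Fin r, partialSum p.1.2 i ^ (if (i : ℕ) + 1 = r then 2 else 1)))
        s := by
  obtain ⟨r, rfl⟩ := Nat.exists_eq_add_of_le' hr
  -- Here all integrations are included: the square on the last partial sum supplies one more
  -- `integ`.
  have hmem : iterInteg (r + 1) (fun i => geom * polylog [k i]) ∈ polylogSpan := by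
    refine iterInteg_mem hr fun i f hf => ?_
    have h1 := polylog_singleton_mem (hk i)
    rw [mul_left_comm]
    refine IsLetter.integ_mul_mem (Or.inr rfl) ?_
    rcases hf with rfl | hf
    · rwa [one_mul]
    · exact mul_mem_polylogSpan hf h1
  obtain ⟨s, hs, hsum⟩ := exists_hasSum_coeff_integ hmem
  refine ⟨s, hs, ?_⟩
  have hg : ∀ n, 0 ≤ coeff n geom := fun n => by
    rw [geom, coeff_mk]; split_ifs <;> simp
  have hP : ∀ (i : Fin (r + 1)) n, 0 ≤ coeff n (geom * polylog [k i]) := fun i =>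
    coeff_mul_nonneg hg (coeff_polylog_nonneg _)
  have hn : ∀ n, (0 : ℝ) ≤ (coeff n (integ (iterInteg (r + 1) fun i => geom * polylog [k i])) : ℚ) :=
    fun n => by exact_mod_cast coeff_integ_nonneg (coeff_iterInteg_nonneg _ _ hP) n
  refine hasSum_of_tsum_ofReal (fun p => ?_) (hsum.nonneg hn) ?_
  · have : ∀ i, 0 ≤ partialSum p.1.2 i := fun i => Finset.sum_nonneg fun j _ => by positivity
    exact mul_nonneg (by positivity)
      (one_div_nonneg.2 (Finset.prod_nonneg fun i _ => pow_nonneg (this i) _))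
  · rw [← hsum.tsum_eq, ENNReal.ofReal_tsum_of_nonneg hn hsum.summable]
    let e : (Fin (r + 1) → {x : ℕ+ × ℕ+ // x.1 < x.2}) ≃
        {p : (Fin (r + 1) → ℕ+) × (Fin (r + 1) → ℕ+) // ∀ i, p.1 i < p.2 i} :=
      { toFun := fun x => ⟨(fun i => (x i).1.1, fun i => (x i).1.2), fun i => (x i).2⟩
        invFun := fun p i => ⟨(p.1.1 i, p.1.2 i), p.2 i⟩
        left_inv := fun x => rfl
        right_inv := fun p => rfl }
    -- The test function `1 / n` accounts for the second factor of the squared total.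
    have := tsum_iterInteg (fun x : {x : ℕ+ × ℕ+ // x.1 < x.2} => (x.1.2 : ℕ)) (r + 1)
      (fun i x => 1 / ((x.1.1 : ℕ) : ℝ) ^ k i) (fun i => geom * polylog [k i])
      (fun i x => by positivity) hP (fun i => tsum_weight_pair _) fun n => ENNReal.ofReal (1 / (n : ℝ))
    simp only [← nnCoeff_integ] at this
    refine Eq.trans ?_ this
    rw [← e.tsum_eq]
    refine tsum_congr fun x => ?_
    rw [prod_partialSum_pow, ← ENNReal.ofReal_mul' (by positivity), mul_assoc, ← one_div_mul_one_div
        (∏ i, _), Finset.prod_div_distrib, Finset.prod_const_one]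
    rfl

end PolylogSeries

theorem theorem1p4 :
    -- (i)
    HasSum
      (fun n : ℕ+ × ℕ+ =>
        1 / (((n.1 : ℕ) : ℝ) * ((n.2 : ℕ) : ℝ)) * betaFactor n.1 n.2)
      (mzv [3]) ∧
    (∀ k l : ℕ, 1 ≤ k → 1 ≤ l →
      HasSum
        (fun n : ℕ+ × ℕ+ =>
          1 / (((n.1 : ℕ) : ℝ) ^ k * ((n.2 : ℕ) : ℝ) ^ l) * betaFactor n.1 n.2)
        (if 2 ≤ l then mzv ((k + 1) :: (List.replicate (l - 2) 1 ++ [2])) else mzv [k + 2])) ∧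
    (∀ k l : ℕ, 1 ≤ k → ∀ hl : 1 ≤ l,
      HasSum
        (fun p : ℕ+ × {m : Fin l → ℕ+ // StrictMono m} =>
          1 / (((p.1 : ℕ) : ℝ) ^ k * ∏ i, ((p.2.1 i : ℕ) : ℝ)) *
            betaFactor p.1 (p.2.1 ⟨l - 1, Nat.sub_lt hl Nat.one_pos⟩))
        (mzv [k + l + 1])) ∧
    -- (ii)
    (∀ (r : ℕ) (k : Fin r → ℕ), 1 ≤ r → (∀ i, 1 ≤ k i) →
      ∃ s ∈ mzvAlgebra,
        HasSum
          (fun n : Fin r → ℕ+ =>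
            1 / (∏ i, ((n i : ℕ) : ℝ) ^ k i) * (1 / ∏ i, partialSum n i))
          s) ∧
    (∀ (r : ℕ) (k : Fin r → ℕ), 1 ≤ r → (∀ i, 1 ≤ k i) →
      ∃ s ∈ mzvAlgebra,
        HasSum
          (fun p : {p : (Fin r → ℕ+) × (Fin r → ℕ+) // ∀ i, p.1 i < p.2 i} =>
            1 / (∏ i, ((p.1.1 i : ℕ) : ℝ) ^ k i) *
              (1 / ∏ i : Fin r, partialSum p.1.2 i ^ (if (i : ℕ) + 1 = r then 2 else 1)))
          s) := by
  refine ⟨?_, fun k l _ hl => hasSum_betaFactor k l hl,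
    fun k l _ hl => hasSum_chain_betaFactor k l hl,
    PolylogSeries.exists_hasSum_partialSum, PolylogSeries.exists_hasSum_partialSum_pair⟩
  simpa using hasSum_betaFactor 1 1 le_rfl
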